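/- Let $d\ge 1$ and let $X_1,\dots,X_{d+2}$ be (possibly dependent) random points in $\mathbb{R}^d$ which are almost surely in general affine position, i.e. almost surely every affine hyperplane contains at most $d$ of them. Let $P=\operatorname{conv}\{X_1,\dots,X_{d+2}\}$, and let $f_\ell(P)$ be the number of $\ell$-dimensional faces of $P$. For $m\in\{0,1,\dots,\lfloor d/2\rfloor\}$ let $T_m^d$ be the combinatorial type (isomorphism class of the face poset) of the polytopes $\operatorname{conv}(V\cup W)\subset\mathbb{R}^d$, where $V=\{v_0,\dots,v_m\}$ and $W=\{w_0,\dots,w_{d-m}\}$ are disjoint sets such that $\operatorname{conv}V$ and $\operatorname{conv}W$ are simplices with vertex sets $V$ and $W$ (of dimensions $m$ and $d-m$) that intersect in a single point, which belongs to the relative interior of each of them. Put $\eta_{d,m}=1$ if $m=d/2$ and $\eta_{d,m}=2$ otherwise. Then the event that $P$ is of type $T_m^d$ is measurable up to null sets, the random variables $f_0(P),\dots,f_m(P)$ are integrable, and for all $m\in\{0,1,\dots,\lfloor d/2\rfloor\}$ $$ p_{d,m}:=\mathbb{P}[P\text{ is of type }T_m^d]=\frac12\,\eta_{d,m}\sum_{\ell=0}^{m}(-1)^{m+\ell}\binom{d-\ell+1}{d-m+1}\left(\binom{d+2}{\ell+1}-\mathbb{E}f_\ell(P)\right).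 $$ -/

import Mathlib

open MeasureTheory

namespace SylvesterTypes

/-- `ℝ^d` with its Euclidean structure. -/
abbrev E (d : ℕ) : Type := EuclideanSpace ℝ (Fin d)

/-- The points `x_i` of `ℝ^d` are in general affine position: every affine hyperplane contains at
most `d` of them (counted by their indices). -/
def InGeneralAffinePosition {d n : ℕ} (x : Fin n → E d) : Prop :=
  ∀ H : AffineSubspace ℝ (E d), (H : Set (E d)).Nonempty →
    Module.finrank ℝ H.direction + 1 = d → {i : Fin n | x i ∈ H}.ncard ≤ d

/-- A (convex) polytope: the convex hull of finitely many points. -/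
def IsPolytope {d : ℕ} (P : Set (E d)) : Prop :=
  ∃ S : Set (E d), S.Finite ∧ P = convexHull ℝ S

/-- The faces of `P`: the empty set and the sets of maximizers over `P` of linear functionals
(the zero functional gives `P` itself). They are ordered by inclusion. -/
abbrev Face {d : ℕ} (P : Set (E d)) : Type :=
  {F : Set (E d) // IsExposed ℝ P F}

/-- Two polytopes are combinatorially equivalent if their face posets are isomorphic. -/
def CombEquiv {d : ℕ} (P Q : Set (E d)) : Prop :=
  Nonempty (Face P ≃o Face Q)

/-- `f_j(P)`: the number of `j`-dimensional faces of `P`. The empty face, whose dimension is `-1`,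
is excluded explicitly because the vector span of the empty set is the zero space. -/
noncomputable def fVec {d : ℕ} (j : ℕ) (P : Set (E d)) : ℕ :=
  {F : Set (E d) | IsExposed ℝ P F ∧ F.Nonempty ∧
    Module.finrank ℝ (vectorSpan ℝ F) = j}.ncard

/-- `T = conv(V ∪ W)`, where `V = {v_0, …, v_m}` and `W = {w_0, …, w_{d-m}}` are disjoint vertex
sets of simplices that meet in a single point, which is in the relative interior of both. -/
def IsModel (d m : ℕ) (T : Set (E d)) : Prop :=
  ∃ (v : Fin (m + 1) → E d) (w : Fin (d - m + 1) → E d) (O : E d),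
    AffineIndependent ℝ v ∧ AffineIndependent ℝ w ∧
    Disjoint (Set.range v) (Set.range w) ∧
    convexHull ℝ (Set.range v) ∩ convexHull ℝ (Set.range w) = {O} ∧
    O ∈ intrinsicInterior ℝ (convexHull ℝ (Set.range v)) ∧
    O ∈ intrinsicInterior ℝ (convexHull ℝ (Set.range w)) ∧
    T = convexHull ℝ (Set.range v ∪ Set.range w)

/-- `P` is a polytope of combinatorial type `T_m^d`: it is combinatorially equivalent to a polytope
`conv(V ∪ W)` as in `IsModel`. -/
def IsOfType (d m : ℕ) (P : Set (E d)) : Prop :=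
  IsPolytope P ∧ ∃ T : Set (E d), IsModel d m T ∧ CombEquiv P T

/-- `η_{d,m} = 1` if `m = d/2` and `η_{d,m} = 2` otherwise. -/
def eta (d m : ℕ) : ℝ := if 2 * m = d then 1 else 2

/-- The random polytope `P = [X_1, …, X_n]`, evaluated at `ω`. -/
def hull {Ω : Type*} {d n : ℕ} (X : Fin n → Ω → E d) (ω : Ω) : Set (E d) :=
  convexHull ℝ (Set.range fun i => X i ω)

end SylvesterTypes

/-! Almost surely the points have, up to scaling, a unique affine dependence `a`, and no coefficient
of it vanishes (`IsCircuit`). Its signs give the Radon partition, with parts of sizes `k + 1` and `d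
+ 1 - k`, where `k ≤ d / 2`.

Everything about `P` can be read off from `k`. The proper faces are exactly the hulls of the index
sets containing neither part (`IsCircuit.isExposed_iff`), and they are simplices.
Inclusion-exclusion then counts them. The total count is strictly monotone in `k`, so the type is
`T_m^d` exactly when `m = k` (`IsCircuit.isOfType_iff`). For `l ≤ d / 2` the count by dimension
gives `f_l = C(d+2, l+1) - C(k+1, d+1-l) - C(d+1-k, d+1-l)`.

This triangular system is inverted by alternating binomial sums (`eta_mul_alternating_sum`), which
expresses the indicator of the type through `f_0, …, f_m` pointwise. Integration yields the formula.
Measurability holds because, in general position, the type is detected by membership in finitely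
many closed sets of configurations (`signedDependent`). -/

namespace SylvesterTypes

/-! ### Convex hulls of finite families and their faces -/

section Hull

variable {ι V : Type*} [Fintype ι] [AddCommGroup V] [Module ℝ V]

/-- Prescribed values at finitely many points that are compatible with all affine dependences of
the points are the values of an affine function. -/
theorem exists_affine_values (x : ι → V) (h : ι → ℝ)
    (H : ∀ b : ι → ℝ, ∑ i, b i = 0 → ∑ i, b i • x i = 0 → ∑ i, b i * h i = 0) :
    ∃ (l : V →ₗ[ℝ] ℝ) (c : ℝ), ∀ i, l (x i) + c = h i := by
  classical
  let T : (ι → ℝ) →ₗ[ℝ] V × ℝ := Fintype.linearCombination ℝ (fun i => (x i, (1 : ℝ)))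
  let φ : (ι → ℝ) →ₗ[ℝ] ℝ := Fintype.linearCombination ℝ h
  -- The kernel of `T` consists of the affine dependences, because the points are lifted to height
  -- one. A functional that kills it factors through `T`.
  have hφ : φ ∈ LinearMap.range T.dualMap := by
    rw [LinearMap.range_dualMap_eq_dualAnnihilator_ker, Submodule.mem_dualAnnihilator]
    intro b hb
    have hb' : ∑ i, b i • (x i, (1 : ℝ)) = 0 := by
      simpa [T, Fintype.linearCombination_apply] using hb
    have h1 := congrArg Prod.fst hb'
    have h2 := congrArg Prod.snd hb'
    simp only [Prod.fst_sum, Prod.snd_sum, Prod.smul_mk, smul_eq_mul, mul_one, Prod.fst_zero,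
      Prod.snd_zero] at h1 h2
    simpa [φ, Fintype.linearCombination_apply] using H b h2 h1
  obtain ⟨g, hg⟩ := hφ
  refine ⟨g ∘ₗ LinearMap.inl ℝ V ℝ, g (0, 1), fun i => ?_⟩
  have h3 := LinearMap.congr_fun hg (Pi.single i 1)
  simp only [LinearMap.dualMap_apply, T, φ, Fintype.linearCombination_apply_single, one_smul] at h3
  rw [← h3, LinearMap.comp_apply, ← map_add]
  simp

theorem mem_convexHull_image_iff (x : ι → V) (S : Set ι) (p : V) :
    p ∈ convexHull ℝ (x '' S) ↔ ∃ c : ι → ℝ, (∀ i, 0 ≤ c i) ∧ (∀ i, i ∉ S → c i = 0) ∧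
      ∑ i, c i = 1 ∧ ∑ i, c i • x i = p := by
  classical
  constructor
  · intro hp
    suffices hs : convexHull ℝ (x '' S) ⊆ {p | ∃ c : ι → ℝ, (∀ i, 0 ≤ c i) ∧
        (∀ i, i ∉ S → c i = 0) ∧ ∑ i, c i = 1 ∧ ∑ i, c i • x i = p} from hs hp
    refine convexHull_min ?_ ?_
    · rintro _ ⟨i, hi, rfl⟩
      refine ⟨Pi.single i 1, fun j => ?_, fun j hj => ?_, by simp, ?_⟩
      · by_cases h : j = i
        · subst h; simp
        · simp [h]
      · exact Pi.single_eq_of_ne (fun h : j = i => hj (h ▸ hi)) _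
      · simp [Pi.single_apply, ite_smul]
    · rintro _ ⟨c, h1, h2, h3, rfl⟩ _ ⟨c', h1', h2', h3', rfl⟩ s t hs ht hst
      refine ⟨fun i => s * c i + t * c' i, fun i => ?_, fun i hi => ?_, ?_, ?_⟩
      · have := h1 i; have := h1' i; positivity
      · simp [h2 i hi, h2' i hi]
      · rw [Finset.sum_add_distrib, ← Finset.mul_sum, ← Finset.mul_sum, h3, h3']; linarith
      · simp only [add_smul, mul_smul, Finset.sum_add_distrib, Finset.smul_sum]
  · rintro ⟨c, h1, h2, h3, rfl⟩
    have e1 : ∑ i with i ∈ S, c i • x i = ∑ i, c i • x i := by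
      refine Finset.sum_subset (Finset.filter_subset _ _) fun i _ hi => ?_
      rw [h2 i (by simpa using hi), zero_smul]
    have e2 : ∑ i with i ∈ S, c i = 1 := by
      rw [← h3]
      refine Finset.sum_subset (Finset.filter_subset _ _) fun i _ hi => h2 i (by simpa using hi)
    rw [← e1]
    refine (convex_convexHull ℝ _).sum_mem (fun i _ => h1 i) e2 fun i hi => ?_
    exact subset_convexHull ℝ _ ⟨i, by simpa using hi, rfl⟩

theorem mem_convexHull_range_iff (x : ι → V) (p : V) :
    p ∈ convexHull ℝ (Set.range x) ↔ ∃ c : ι → ℝ, (∀ i, 0 ≤ c i) ∧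
      ∑ i, c i = 1 ∧ ∑ i, c i • x i = p := by
  rw [← Set.image_univ, mem_convexHull_image_iff]
  simp

/-- The face of a convex hull in which a linear functional is maximal is the convex hull of the
points in which it is maximal. -/
theorem maximizers_convexHull_range (x : ι → V) (l : V →ₗ[ℝ] ℝ) (c : ℝ) (hle : ∀ i, l (x i) ≤ c)
    (hne : ∃ i, l (x i) = c) :
    {p ∈ convexHull ℝ (Set.range x) | ∀ y ∈ convexHull ℝ (Set.range x), l y ≤ l p} =
      convexHull ℝ (x '' {i | l (x i) = c}) := by
  classical
  have hl : ∀ (w : ι → ℝ), l (∑ i, w i • x i) = ∑ i, w i * l (x i) := fun w => by simp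
  ext p
  rw [mem_convexHull_image_iff]
  simp only [Set.mem_ofPred_eq, mem_convexHull_range_iff]
  constructor
  · rintro ⟨⟨w, h0, h1, rfl⟩, hmax⟩
    obtain ⟨j, hj⟩ := hne
    refine ⟨w, h0, fun i hi => ?_, h1, rfl⟩
    have h2 := hmax (x j) ((mem_convexHull_range_iff x _).1
      (subset_convexHull ℝ _ (Set.mem_range_self j)))
    rw [hj, hl] at h2
    have h3 : ∑ i, w i * (c - l (x i)) ≤ 0 := by
      simp only [mul_sub, Finset.sum_sub_distrib, ← Finset.sum_mul, h1]
      linarith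
    have h4 : ∀ i ∈ Finset.univ, 0 ≤ w i * (c - l (x i)) := fun i _ =>
      mul_nonneg (h0 i) (sub_nonneg.2 (hle i))
    have h5 := (Finset.sum_eq_zero_iff_of_nonneg h4).1 (le_antisymm h3 (Finset.sum_nonneg h4)) i
      (Finset.mem_univ i)
    rcases mul_eq_zero.1 h5 with h | h
    · exact h
    · exact absurd (by linarith) hi
  · rintro ⟨w, h0, hS, h1, rfl⟩
    refine ⟨⟨w, h0, h1, rfl⟩, ?_⟩
    rintro _ ⟨w', h0', h1', rfl⟩
    rw [hl, hl]
    have e : ∑ i, w i * l (x i) = ∑ i, w i * c := by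
      refine Finset.sum_congr rfl fun i _ => ?_
      by_cases hi : l (x i) = c
      · rw [hi]
      · rw [hS i hi]; simp
    rw [e, ← Finset.sum_mul, h1, ← h1', Finset.sum_mul]
    exact Finset.sum_le_sum fun i _ => mul_le_mul_of_nonneg_left (hle i) (h0' i)

end Hull

/-! ### Relative interiors of simplices -/

section Interior

variable {ι V : Type*} [Fintype ι] [NormedAddCommGroup V] [NormedSpace ℝ V]

theorem affineIndependent_iff_forall_sum {x : ι → V} : AffineIndependent ℝ x ↔
    ∀ b : ι → ℝ, ∑ i, b i = 0 → ∑ i, b i • x i = 0 → ∀ i, b i = 0 := by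
  classical
  rw [affineIndependent_iff]
  refine ⟨fun h b h1 h2 i => h Finset.univ b h1 h2 i (Finset.mem_univ i), fun h s w h1 h2 i hi => ?_⟩
  have := h (fun i => if i ∈ s then w i else 0) (by simpa using h1)
    (by simpa [ite_smul] using h2) i
  simpa [hi] using this

/-- From a point of the intrinsic interior one can move away a little from any point of the set. -/
theorem exists_extend_of_mem_intrinsicInterior {K : Set V} {o p : V}
    (ho : o ∈ intrinsicInterior ℝ K) (hp : p ∈ K) : ∃ t : ℝ, 0 < t ∧ o + t • (o - p) ∈ K := by
  obtain ⟨y, hy, rfl⟩ := mem_intrinsicInterior.1 ho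
  have hmem : ∀ t : ℝ, (y : V) + t • ((y : V) - p) ∈ affineSpan ℝ K := fun t => by
    have := AffineSubspace.smul_vsub_vadd_mem (affineSpan ℝ K) t y.2 (subset_affineSpan ℝ K hp) y.2
    rwa [vsub_eq_sub, vadd_eq_add, add_comm] at this
  let g : ℝ → affineSpan ℝ K := fun t => ⟨(y : V) + t • ((y : V) - p), hmem t⟩
  have hg : Continuous g := by
    refine Continuous.subtype_mk ?_ _
    fun_prop
  have hg0 : g 0 = y := by ext; simp [g]
  have hnhds : ∀ᶠ t in nhds (0 : ℝ), g t ∈ ((↑) ⁻¹' K : Set (affineSpan ℝ K)) :=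
    hg.continuousAt.eventually (by rw [hg0]; exact mem_interior_iff_mem_nhds.1 hy)
  obtain ⟨t, ht, ht0⟩ := ((hnhds.filter_mono nhdsWithin_le_nhds).and
    (self_mem_nhdsWithin : Set.Ioi (0 : ℝ) ∈ nhdsWithin 0 (Set.Ioi 0))).exists
  exact ⟨t, ht0, ht⟩

/-- The intrinsic interior of a simplex consists of the points with positive barycentric
coordinates. -/
theorem mem_intrinsicInterior_simplex_iff [FiniteDimensional ℝ V] {x : ι → V}
    (hx : AffineIndependent ℝ x) (o : V) :
    o ∈ intrinsicInterior ℝ (convexHull ℝ (Set.range x)) ↔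
      ∃ c : ι → ℝ, (∀ i, 0 < c i) ∧ ∑ i, c i = 1 ∧ ∑ i, c i • x i = o := by
  classical
  rw [affineIndependent_iff_forall_sum] at hx
  constructor
  · intro ho
    obtain ⟨c, h0, h1, rfl⟩ := (mem_convexHull_range_iff x o).1 (intrinsicInterior_subset ho)
    refine ⟨c, fun j => lt_of_le_of_ne (h0 j) fun hj => ?_, h1, rfl⟩
    -- If the `j`-th coordinate vanished, moving away from `x j` would stay in the simplex but make
    -- that coordinate `-t`.
    obtain ⟨t, ht, htK⟩ := exists_extend_of_mem_intrinsicInterior ho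
      (subset_convexHull ℝ _ (Set.mem_range_self j))
    obtain ⟨c', h0', h1', he⟩ := (mem_convexHull_range_iff x _).1 htK
    have := hx (fun i => c' i - (c i + t * (c i - if i = j then 1 else 0)))
      (by
        simp only [Finset.sum_sub_distrib, Finset.sum_add_distrib, ← Finset.mul_sum, h1, h1']
        simp)
      (by
        simp only [sub_smul, add_smul, mul_smul, Finset.sum_sub_distrib, Finset.sum_add_distrib,
          ← Finset.smul_sum, he]
        simp [ite_smul]) j
    have h3 := h0' j
    simp only [← hj, if_true] at this
    linarith
  · rintro ⟨c, h0, h1, rfl⟩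
    -- The functions `l j + k j` are the barycentric coordinates; their positivity cuts out an open
    -- set.
    choose l k hlk using fun j => exists_affine_values x (fun i => if i = j then (1 : ℝ) else 0)
      (fun b hb hb' => by simp [hx b hb hb'])
    have hval : ∀ (w : ι → ℝ) (j : ι), ∑ i, w i = 1 → l j (∑ i, w i • x i) + k j = w j := by
      intro w j hw
      have : k j = ∑ i, w i * k j := by rw [← Finset.sum_mul, hw, one_mul]
      rw [this, map_sum, ← Finset.sum_add_distrib]
      simp only [map_smul, smul_eq_mul, ← mul_add, hlk]
      simp
    have hcx : ∑ i, c i • x i ∈ convexHull ℝ (Set.range x) :=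
      (mem_convexHull_range_iff x _).2 ⟨c, fun i => (h0 i).le, h1, rfl⟩
    refine mem_intrinsicInterior.2 ⟨⟨_, subset_affineSpan ℝ _ hcx⟩, ?_, rfl⟩
    rw [mem_interior]
    refine ⟨⋂ j, {y | 0 < l j (y : V) + k j}, ?_, ?_, ?_⟩
    · rintro ⟨y, hy⟩ hpos
      rw [affineSpan_convexHull] at hy
      obtain ⟨w, hw, rfl⟩ := eq_affineCombination_of_mem_affineSpan_of_fintype hy
      have hpos' : ∀ j, 0 < w j := by
        intro j
        have := Set.mem_iInter.1 hpos j
        simp only [Set.mem_ofPred_eq,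
          Finset.affineCombination_eq_linear_combination _ _ _ hw, hval w j hw] at this
        exact this
      simp only [Set.mem_preimage, Finset.affineCombination_eq_linear_combination _ _ _ hw]
      exact (mem_convexHull_range_iff x _).2 ⟨w, fun i => (hpos' i).le, hw, rfl⟩
    · refine isOpen_iInter_of_finite fun j => ?_
      have := (l j).continuous_of_finiteDimensional
      exact isOpen_lt continuous_const (by fun_prop)
    · refine Set.mem_iInter.2 fun j => ?_
      simp only [Set.mem_ofPred_eq, hval c j h1]
      exact h0 j

end Interior

/-! ### Circuits and the faces of their convex hulls -/

/-- The points `x i` have, up to scaling, the only affine dependence `a`, and none of its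
coefficients vanishes. -/
structure IsCircuit {ι V : Type*} [Fintype ι] [AddCommGroup V] [Module ℝ V] (x : ι → V)
    (a : ι → ℝ) : Prop where
  ne_zero : ∀ i, a i ≠ 0
  sum_eq : ∑ i, a i = 0
  sum_smul_eq : ∑ i, a i • x i = 0
  unique : ∀ b : ι → ℝ, ∑ i, b i = 0 → ∑ i, b i • x i = 0 → ∃ t : ℝ, ∀ i, b i = t * a i

/-- The index sets that contain neither the positive nor the negative part of `a`. -/
def IsFaceSet {ι : Type*} (a : ι → ℝ) (S : Set ι) : Prop :=
  (∃ i, i ∉ S ∧ 0 < a i) ∧ ∃ i, i ∉ S ∧ a i < 0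

namespace IsCircuit

variable {ι V : Type*} [Fintype ι] [NormedAddCommGroup V] [NormedSpace ℝ V] {x : ι → V} {a : ι → ℝ}

theorem neg (h : IsCircuit x a) : IsCircuit x (-a) where
  ne_zero i := neg_ne_zero.2 (h.ne_zero i)
  sum_eq := by simp [h.sum_eq]
  sum_smul_eq := by simp [h.sum_smul_eq]
  unique b h1 h2 := by
    obtain ⟨t, ht⟩ := h.unique b h1 h2
    exact ⟨-t, fun i => by simp [ht i]⟩

theorem exists_pos [Nonempty ι] (h : IsCircuit x a) : ∃ i, 0 < a i := by
  by_contra! hn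
  have := (Finset.sum_eq_zero_iff_of_nonpos fun i _ => hn i).1 h.sum_eq
  exact h.ne_zero (Classical.arbitrary ι) (this _ (Finset.mem_univ _))

theorem exists_neg [Nonempty ι] (h : IsCircuit x a) : ∃ i, a i < 0 := by
  obtain ⟨i, hi⟩ := h.neg.exists_pos
  exact ⟨i, by simpa using hi⟩

theorem isFaceSet_empty [Nonempty ι] (h : IsCircuit x a) : IsFaceSet a ∅ := by
  obtain ⟨i, hi⟩ := h.exists_pos
  obtain ⟨j, hj⟩ := h.exists_neg
  exact ⟨⟨i, by simp, hi⟩, j, by simp, hj⟩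

/-- A supporting functional of the face spanned by an admissible index set. -/
theorem exists_support (h : IsCircuit x a) {S : Set ι} (hS : IsFaceSet a S) :
    ∃ (l : V →ₗ[ℝ] ℝ) (c : ℝ), (∀ i ∈ S, l (x i) = c) ∧ ∀ i, i ∉ S → l (x i) < c := by
  classical
  obtain ⟨⟨i₀, hi₀, hp⟩, j₀, hj₀, hn⟩ := hS
  let P : Finset ι := Finset.univ.filter fun i => i ∉ S ∧ 0 < a i
  let N : Finset ι := Finset.univ.filter fun i => i ∉ S ∧ a i < 0
  have hP : 0 < (P.card : ℝ) := by
    exact_mod_cast Finset.card_pos.2 ⟨i₀, by simp [P, hi₀, hp]⟩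
  have hN : 0 < (N.card : ℝ) := by
    exact_mod_cast Finset.card_pos.2 ⟨j₀, by simp [N, hj₀, hn]⟩
  -- Values that vanish on `S`, are negative off `S` and are orthogonal to `a`: the positive
  -- coefficients off `S` contribute `-1` in total, the negative ones `+1`.
  let f : ι → ℝ := fun i => (if i ∈ P then -(P.card * a i)⁻¹ else 0) +
    if i ∈ N then (N.card * a i)⁻¹ else 0
  have hf : ∑ i, a i * f i = 0 := by
    have e1 : ∑ i, a i * (if i ∈ P then -(P.card * a i)⁻¹ else 0) = -1 := by
      simp only [mul_ite, mul_zero, Finset.sum_ite_mem, Finset.univ_inter]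
      rw [Finset.sum_congr rfl (g := fun _ => -(P.card : ℝ)⁻¹)
        (fun i _ => by have := h.ne_zero i; field_simp)]
      simp [hP.ne']
    have e2 : ∑ i, a i * (if i ∈ N then (N.card * a i)⁻¹ else 0) = 1 := by
      simp only [mul_ite, mul_zero, Finset.sum_ite_mem, Finset.univ_inter]
      rw [Finset.sum_congr rfl (g := fun _ => (N.card : ℝ)⁻¹)
        (fun i _ => by have := h.ne_zero i; field_simp)]
      simp [hN.ne']
    simp only [f, mul_add, Finset.sum_add_distrib, e1, e2]
    norm_num
  obtain ⟨l, c, hl⟩ := exists_affine_values x f (fun b h1 h2 => by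
    obtain ⟨t, ht⟩ := h.unique b h1 h2
    simp only [ht, mul_assoc, ← Finset.mul_sum, hf, mul_zero])
  refine ⟨l, -c, fun i hi => ?_, fun i hi => ?_⟩
  · have h3 := hl i
    have : f i = 0 := by simp [f, P, N, hi]
    linarith
  · have h3 := hl i
    have : f i < 0 := by
      rcases lt_or_gt_of_ne (h.ne_zero i) with h4 | h4
      · have h5 : (N.card * a i)⁻¹ < 0 := inv_lt_zero.2 (mul_neg_of_pos_of_neg hN h4)
        simpa [f, P, N, hi, h4, h4.le, not_lt.2 h4.le] using h5
      · have h5 : 0 < (P.card * a i)⁻¹ := inv_pos.2 (mul_pos hP h4)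
        simpa [f, P, N, hi, h4, h4.le, not_lt.2 h4.le] using h5
    linarith

/-- The points of the circuit in the face of an admissible index set are those of the set. -/
theorem mem_convexHull_image (h : IsCircuit x a) {S : Set ι} (hS : IsFaceSet a S) (i : ι) :
    x i ∈ convexHull ℝ (x '' S) ↔ i ∈ S := by
  refine ⟨fun hi => ?_, fun hi => subset_convexHull ℝ _ ⟨i, hi, rfl⟩⟩
  by_contra hn
  obtain ⟨l, c, h1, h2⟩ := h.exists_support hS
  obtain ⟨w, -, h0, hw, he⟩ := (mem_convexHull_image_iff x S _).1 hi
  have : l (x i) = c := by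
    rw [← he, map_sum, ← one_mul c, ← hw, Finset.sum_mul]
    refine Finset.sum_congr rfl fun j _ => ?_
    by_cases hj : j ∈ S
    · rw [map_smul, h1 j hj, smul_eq_mul]
    · rw [h0 j hj]; simp
  exact absurd (h2 i hn) (by rw [this]; exact lt_irrefl _)

/-- The slacks `c - l (x i)` are nonnegative and orthogonal to `a`. If the coefficients off the
maximal set had only one sign, all slacks would vanish. -/
theorem isFaceSet_of_maximizers (h : IsCircuit x a) {l : V →ₗ[ℝ] ℝ} {c : ℝ}
    (hle : ∀ i, l (x i) ≤ c) (hne : ∃ i, l (x i) ≠ c) : IsFaceSet a {i | l (x i) = c} := by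
  have hsum : ∑ i, a i * (c - l (x i)) = 0 := by
    have : ∑ i, a i * l (x i) = 0 := by
      have := congrArg l h.sum_smul_eq
      simpa using this
    simp only [mul_sub, Finset.sum_sub_distrib, ← Finset.sum_mul, h.sum_eq, this]
    simp
  obtain ⟨j, hj⟩ := hne
  have hj' : c - l (x j) ≠ 0 := fun h => hj (by linarith)
  constructor
  · by_contra! hn
    have h1 : ∀ i ∈ Finset.univ, a i * (c - l (x i)) ≤ 0 := fun i _ => by
      by_cases hi : l (x i) = c
      · simp [hi]
      · exact mul_nonpos_of_nonpos_of_nonneg (hn i hi) (sub_nonneg.2 (hle i))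
    have := (Finset.sum_eq_zero_iff_of_nonpos h1).1 hsum j (Finset.mem_univ j)
    exact (mul_ne_zero (h.ne_zero j) hj') this
  · by_contra! hn
    have h1 : ∀ i ∈ Finset.univ, 0 ≤ a i * (c - l (x i)) := fun i _ => by
      by_cases hi : l (x i) = c
      · simp [hi]
      · exact mul_nonneg (hn i hi) (sub_nonneg.2 (hle i))
    have := (Finset.sum_eq_zero_iff_of_nonneg h1).1 hsum j (Finset.mem_univ j)
    exact (mul_ne_zero (h.ne_zero j) hj') this

theorem isExposed_iff [FiniteDimensional ℝ V] [Nonempty ι] (h : IsCircuit x a) (F : Set V) :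
    IsExposed ℝ (convexHull ℝ (Set.range x)) F ↔
      F = convexHull ℝ (Set.range x) ∨ ∃ S, IsFaceSet a S ∧ convexHull ℝ (x '' S) = F := by
  constructor
  · intro hF
    rcases F.eq_empty_or_nonempty with rfl | hne
    · exact Or.inr ⟨∅, h.isFaceSet_empty, by simp⟩
    · obtain ⟨l, rfl⟩ := hF hne
      obtain ⟨j, hj⟩ := Finite.exists_max fun i => l (x i)
      have hm := maximizers_convexHull_range x (l : V →ₗ[ℝ] ℝ) (l (x j)) hj ⟨j, rfl⟩
      simp only [ContinuousLinearMap.coe_coe] at hm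
      rw [hm]
      by_cases hall : ∀ i, l (x i) = l (x j)
      · left
        simp [hall]
      · exact Or.inr ⟨_, h.isFaceSet_of_maximizers (l := (l : V →ₗ[ℝ] ℝ)) hj
          (by simpa using hall), rfl⟩
  · rintro (rfl | ⟨S, hS, rfl⟩)
    · exact IsExposed.refl _
    · rcases S.eq_empty_or_nonempty with rfl | ⟨j, hj⟩
      · simpa using isExposed_empty
      · obtain ⟨l, c, h1, h2⟩ := h.exists_support hS
        have hle : ∀ i, l (x i) ≤ c := fun i => by
          by_cases hi : i ∈ S
          · exact (h1 i hi).le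
          · exact (h2 i hi).le
        have hSe : {i | l (x i) = c} = S := by
          ext i
          refine ⟨fun hi => ?_, h1 i⟩
          by_contra hn
          exact (h2 i hn).ne hi
        intro _
        refine ⟨LinearMap.toContinuousLinearMap l, ?_⟩
        rw [← hSe]
        exact (maximizers_convexHull_range x l c hle ⟨j, h1 j hj⟩).symm

theorem convexHull_image_injOn (h : IsCircuit x a) :
    Set.InjOn (fun S : Set ι => convexHull ℝ (x '' S)) {S | IsFaceSet a S} := by
  intro S hS T hT hST
  ext i
  rw [← h.mem_convexHull_image hS, ← h.mem_convexHull_image hT]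
  exact iff_of_eq (congrArg (x i ∈ ·) hST)

theorem convexHull_image_ne (h : IsCircuit x a) {S : Set ι} (hS : IsFaceSet a S) :
    convexHull ℝ (x '' S) ≠ convexHull ℝ (Set.range x) := by
  intro he
  obtain ⟨i, hi, -⟩ := hS.1
  refine hi ((h.mem_convexHull_image hS i).1 ?_)
  rw [he]
  exact subset_convexHull ℝ _ (Set.mem_range_self i)

/-- A dependence on `S`, extended by zero, is a multiple of `a` that vanishes at `i`, hence is zero.
-/
theorem affineIndependent_restrict (h : IsCircuit x a) {S : Set ι} {i : ι} (hi : i ∉ S) :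
    AffineIndependent ℝ (fun j : S => x j) := by
  classical
  rw [affineIndependent_iff_forall_sum]
  intro b h1 h2 j
  let b' : ι → ℝ := fun k => if hk : k ∈ S then b ⟨k, hk⟩ else 0
  have hb' : ∀ k : S, b' k = b k := fun k => by simp [b']
  have hoff : ∀ k, k ∉ S → b' k = 0 := fun k hk => by simp [b', hk]
  have e1 : ∑ k, b' k = ∑ k : S, b k := by
    simp only [← hb']
    rw [← Finset.sum_subtype (Finset.univ.filter (· ∈ S)) (by simp) b']
    exact (Finset.sum_subset (Finset.filter_subset _ _) fun k _ hk =>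
      hoff k (by simpa using hk)).symm
  have e2 : ∑ k, b' k • x k = ∑ k : S, b k • x k := by
    simp only [← hb']
    rw [← Finset.sum_subtype (Finset.univ.filter (· ∈ S)) (by simp) (fun k => b' k • x k)]
    refine (Finset.sum_subset (Finset.filter_subset _ _) fun k _ hk => ?_).symm
    rw [hoff k (by simpa using hk), zero_smul]
  obtain ⟨t, ht⟩ := h.unique b' (e1.trans h1) (e2.trans h2)
  have h0 : t = 0 := by
    have := ht i
    simp only [b', hi, dif_neg, not_false_eq_true] at this
    exact (mul_eq_zero.1 this.symm).resolve_right (h.ne_zero i)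
  rw [← hb' j, ht, h0, zero_mul]

theorem finrank_vectorSpan_image (h : IsCircuit x a) {S : Set ι} {i : ι} (hi : i ∉ S)
    (hne : S.Nonempty) :
    Module.finrank ℝ (vectorSpan ℝ (convexHull ℝ (x '' S))) + 1 = S.ncard := by
  classical
  have hr : x '' S = Set.range fun j : S => x j := by
    rw [← Set.image_eq_range]
  have hpos : 0 < S.ncard := (Set.ncard_pos).2 hne
  have hd : vectorSpan ℝ (convexHull ℝ (x '' S)) = vectorSpan ℝ (x '' S) := by
    rw [← direction_affineSpan, affineSpan_convexHull, direction_affineSpan]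
  rw [hd, hr, (h.affineIndependent_restrict hi).finrank_vectorSpan (n := S.ncard - 1)]
  · omega
  · rw [Fintype.card_eq_nat_card, Nat.card_coe_set_eq]
    omega

end IsCircuit

/-! ### Counting the faces of a circuit -/

theorem card_filter_superset {ι : Type*} [Fintype ι] [DecidableEq ι] (A : Finset ι) :
    (Finset.univ.filter fun S : Finset ι => A ⊆ S).card = 2 ^ Aᶜ.card := by
  have : (Finset.univ.filter fun S : Finset ι => A ⊆ S) = Finset.Icc A Finset.univ := by
    ext S; simp
  rw [this, Finset.card_Icc_finset (Finset.subset_univ A), Finset.card_compl, Finset.card_univ]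

theorem card_filter_superset_card {ι : Type*} [Fintype ι] [DecidableEq ι] (A : Finset ι) {k : ℕ}
    (hk : k ≤ Fintype.card ι) :
    (Finset.univ.filter fun S : Finset ι => A ⊆ S ∧ S.card = k).card =
      Aᶜ.card.choose (Fintype.card ι - k) := by
  rw [← Finset.card_powersetCard]
  refine Finset.card_nbij' (fun S => Sᶜ) (fun S => Sᶜ) ?_ ?_ (fun S _ => compl_compl S)
    (fun S _ => compl_compl S)
  · intro S hS
    simp only [Finset.coe_filter, Finset.mem_univ, true_and, Set.mem_ofPred_eq] at hS
    simp only [Finset.mem_coe, Finset.mem_powersetCard, Finset.card_compl, hS.2, and_true]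
    exact Finset.compl_subset_compl.2 hS.1
  · intro S hS
    simp only [Finset.mem_coe, Finset.mem_powersetCard] at hS
    simp only [Finset.coe_filter, Finset.mem_univ, true_and, Set.mem_ofPred_eq, Finset.card_compl,
      hS.2]
    exact ⟨Finset.subset_compl_comm.1 hS.1, by omega⟩

/-- Inclusion-exclusion for the index sets that contain neither of two complementary sets. -/
theorem card_filter_not_superset {ι : Type*} [Fintype ι] [DecidableEq ι] (A : Finset ι)
    (p : Finset ι → Prop) [DecidablePred p] :
    (Finset.univ.filter fun S : Finset ι => (¬ A ⊆ S ∧ ¬ Aᶜ ⊆ S) ∧ p S).card +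
      ((Finset.univ.filter fun S : Finset ι => A ⊆ S ∧ p S).card +
        (Finset.univ.filter fun S : Finset ι => Aᶜ ⊆ S ∧ p S).card) =
      (Finset.univ.filter p).card + if p Finset.univ then 1 else 0 := by
  have h1 : (if p Finset.univ then 1 else 0) =
      (Finset.univ.filter fun S : Finset ι => (A ⊆ S ∧ Aᶜ ⊆ S) ∧ p S).card := by
    have : ∀ S : Finset ι, (A ⊆ S ∧ Aᶜ ⊆ S) ∧ p S ↔ S = Finset.univ ∧ p Finset.univ := by
      intro S
      rw [← Finset.union_subset_iff, Finset.union_compl, Finset.univ_subset_iff]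
      constructor
      · rintro ⟨rfl, h⟩; exact ⟨rfl, h⟩
      · rintro ⟨rfl, h⟩; exact ⟨rfl, h⟩
    simp only [this]
    split_ifs with h <;> simp [h, Finset.filter_eq']
  rw [h1]
  simp only [Finset.card_filter, ← Finset.sum_add_distrib]
  refine Finset.sum_congr rfl fun S _ => ?_
  by_cases h2 : A ⊆ S <;> by_cases h3 : Aᶜ ⊆ S <;> by_cases h4 : p S <;> simp [h2, h3, h4]

/-- The indices of positive coefficients. -/
noncomputable def posPart {ι : Type*} [Fintype ι] (a : ι → ℝ) : Finset ι :=
  Finset.univ.filter fun i => 0 < a i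

theorem mem_posPart {ι : Type*} [Fintype ι] {a : ι → ℝ} {i : ι} : i ∈ posPart a ↔ 0 < a i := by
  simp [posPart]

namespace IsCircuit

variable {ι V : Type*} [Fintype ι] [DecidableEq ι] [NormedAddCommGroup V] [NormedSpace ℝ V]
  {x : ι → V} {a : ι → ℝ}

theorem mem_compl_posPart (h : IsCircuit x a) {i : ι} : i ∈ (posPart a)ᶜ ↔ a i < 0 := by
  rw [Finset.mem_compl, mem_posPart, not_lt]
  exact ⟨fun h' => lt_of_le_of_ne h' (h.ne_zero i), le_of_lt⟩

theorem posPart_neg (h : IsCircuit x a) : posPart (-a) = (posPart a)ᶜ := by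
  ext i
  rw [mem_posPart, h.mem_compl_posPart]
  simp

theorem isFaceSet_coe_iff (h : IsCircuit x a) (S : Finset ι) :
    IsFaceSet a (S : Set ι) ↔ ¬ posPart a ⊆ S ∧ ¬ (posPart a)ᶜ ⊆ S := by
  simp only [IsFaceSet, Finset.not_subset, mem_posPart, h.mem_compl_posPart, Finset.mem_coe]
  exact and_congr (exists_congr fun i => and_comm) (exists_congr fun i => and_comm)

theorem ncard_isFaceSet (h : IsCircuit x a) (p : Finset ι → Prop) [DecidablePred p] :
    {S : Set ι | IsFaceSet a S ∧ ∃ T : Finset ι, (T : Set ι) = S ∧ p T}.ncard =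
      (Finset.univ.filter fun S : Finset ι =>
        (¬ posPart a ⊆ S ∧ ¬ (posPart a)ᶜ ⊆ S) ∧ p S).card := by
  rw [← Set.ncard_coe_finset, ← Set.ncard_image_of_injective _ Finset.coe_injective]
  congr 1
  ext S
  simp only [Set.mem_ofPred_eq, Finset.coe_filter, Finset.mem_univ, true_and, Set.mem_image]
  constructor
  · rintro ⟨h1, T, rfl, h2⟩
    exact ⟨T, ⟨(h.isFaceSet_coe_iff T).1 h1, h2⟩, rfl⟩
  · rintro ⟨T, ⟨h1, h2⟩, rfl⟩
    exact ⟨(h.isFaceSet_coe_iff T).2 h1, T, rfl, h2⟩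

/-- In the term `+ 2`, one unit corrects for the full index set, which contains both parts, and the
other counts the polytope itself. -/
theorem ncard_exposed_add [FiniteDimensional ℝ V] [Nonempty ι] (h : IsCircuit x a) :
    {F : Set V | IsExposed ℝ (convexHull ℝ (Set.range x)) F}.ncard +
      (2 ^ (posPart a).card + 2 ^ (posPart a)ᶜ.card) = 2 ^ Fintype.card ι + 2 := by
  have h1 : {F : Set V | IsExposed ℝ (convexHull ℝ (Set.range x)) F} =
      insert (convexHull ℝ (Set.range x))
        ((fun S : Set ι => convexHull ℝ (x '' S)) '' {S | IsFaceSet a S}) := by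
    ext F
    simp only [Set.mem_ofPred_eq, h.isExposed_iff, Set.mem_insert_iff, Set.mem_image]
  have h2 : {S | IsFaceSet a S} = {S : Set ι | IsFaceSet a S ∧ ∃ T : Finset ι,
      (T : Set ι) = S ∧ True} := by
    ext S
    simp only [Set.mem_ofPred_eq, and_true, iff_self_and]
    exact fun _ => ⟨S.toFinite.toFinset, by simp⟩
  rw [h1, Set.ncard_insert_of_notMem, h.convexHull_image_injOn.ncard_image, h2,
    h.ncard_isFaceSet]
  · have h3 := card_filter_not_superset (posPart a) (fun _ => True)
    simp only [and_true, if_true, card_filter_superset, compl_compl, Finset.filter_true,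
      Finset.card_univ, Fintype.card_finset] at h3 ⊢
    omega
  · rintro ⟨S, hS, he⟩
    exact h.convexHull_image_ne hS he

-- Deleting one point leaves an affinely independent family.
omit [DecidableEq ι] in
theorem le_finrank_vectorSpan [FiniteDimensional ℝ V] [Nonempty ι] (h : IsCircuit x a) :
    Fintype.card ι ≤ Module.finrank ℝ (vectorSpan ℝ (convexHull ℝ (Set.range x))) + 2 := by
  let i : ι := Classical.arbitrary ι
  rcases ({i}ᶜ : Set ι).eq_empty_or_nonempty with he | hne
  · have : Fintype.card ι ≤ 1 := Fintype.card_le_one_iff.2 fun b c => by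
      rw [Set.compl_empty_iff] at he
      have hb : b ∈ ({i} : Set ι) := he ▸ Set.mem_univ b
      have hc : c ∈ ({i} : Set ι) := he ▸ Set.mem_univ c
      rw [hb, hc]
    omega
  · have h1 := h.finrank_vectorSpan_image (S := {i}ᶜ) (i := i) (by simp) hne
    have h2 : ({i}ᶜ : Set ι).ncard + 1 = Fintype.card ι := by
      have := Set.ncard_add_ncard_compl ({i} : Set ι)
      rw [Set.ncard_singleton, Nat.card_eq_fintype_card] at this
      omega
    have h3 : Module.finrank ℝ (vectorSpan ℝ (convexHull ℝ (x '' {i}ᶜ))) ≤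
        Module.finrank ℝ (vectorSpan ℝ (convexHull ℝ (Set.range x))) :=
      Submodule.finrank_mono (vectorSpan_mono ℝ (convexHull_mono (Set.image_subset_range _ _)))
    omega

/-- The bound on `l` keeps the polytope itself out of the count, so only simplices with `l + 1`
vertices remain. -/
theorem ncard_faces_add [FiniteDimensional ℝ V] [Nonempty ι] (h : IsCircuit x a) {l : ℕ}
    (hl : l + 2 < Fintype.card ι) :
    {F : Set V | IsExposed ℝ (convexHull ℝ (Set.range x)) F ∧ F.Nonempty ∧
      Module.finrank ℝ (vectorSpan ℝ F) = l}.ncard +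
      ((posPart a).card.choose (Fintype.card ι - (l + 1)) +
        (posPart a)ᶜ.card.choose (Fintype.card ι - (l + 1))) =
      (Fintype.card ι).choose (l + 1) := by
  have h1 : {F : Set V | IsExposed ℝ (convexHull ℝ (Set.range x)) F ∧ F.Nonempty ∧
      Module.finrank ℝ (vectorSpan ℝ F) = l} = (fun S : Set ι => convexHull ℝ (x '' S)) ''
        {S : Set ι | IsFaceSet a S ∧ ∃ T : Finset ι, (T : Set ι) = S ∧ T.card = l + 1} := by
    ext F
    simp only [Set.mem_ofPred_eq, h.isExposed_iff, Set.mem_image]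
    constructor
    · rintro ⟨rfl | ⟨S, hS, rfl⟩, hne, hd⟩
      · have := h.le_finrank_vectorSpan
        omega
      · obtain ⟨i, hi, -⟩ := hS.1
        have hSne : S.Nonempty := by simpa using hne
        have h2 := h.finrank_vectorSpan_image hi hSne
        refine ⟨S, ⟨hS, S.toFinite.toFinset, by simp, ?_⟩, rfl⟩
        rw [← Set.ncard_eq_toFinset_card]
        omega
    · rintro ⟨_, ⟨hS, T, rfl, hT⟩, rfl⟩
      have hTne : (T : Set ι).Nonempty := Finset.coe_nonempty.2 (Finset.card_pos.1 (by omega))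
      refine ⟨Or.inr ⟨_, hS, rfl⟩, by simpa using hTne, ?_⟩
      obtain ⟨i, hi, -⟩ := hS.1
      have h2 := h.finrank_vectorSpan_image hi hTne
      rw [Set.ncard_coe_finset] at h2
      omega
  rw [h1, (h.convexHull_image_injOn.mono fun S hS => hS.1).ncard_image,
    h.ncard_isFaceSet]
  have h3 := card_filter_not_superset (posPart a) (fun S => S.card = l + 1)
  rw [card_filter_superset_card _ (by omega), card_filter_superset_card _ (by omega), compl_compl,
    if_neg (by rw [Finset.card_univ]; omega), Finset.univ_filter_card_eq,
    Finset.card_powersetCard, Finset.card_univ] at h3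
  omega

end IsCircuit

/-! ### Circuits as pairs of simplices crossing in one point -/

namespace IsCircuit

section Reindex

variable {ι κ V : Type*} [Fintype ι] [Fintype κ] [AddCommGroup V] [Module ℝ V]
  {x : ι → V} {a : ι → ℝ}

theorem comp_equiv (h : IsCircuit x a) (e : κ ≃ ι) : IsCircuit (x ∘ e) (a ∘ e) where
  ne_zero i := h.ne_zero (e i)
  sum_eq := by rw [← h.sum_eq]; exact Equiv.sum_comp e a
  sum_smul_eq := by rw [← h.sum_smul_eq]; exact Equiv.sum_comp e fun i => a i • x i
  unique b h1 h2 := by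
    obtain ⟨t, ht⟩ := h.unique (b ∘ e.symm) (by rw [← h1]; exact Equiv.sum_comp e.symm b)
      (by
        rw [← h2, ← Equiv.sum_comp e]
        simp)
    exact ⟨t, fun i => by simpa using ht (e i)⟩

/-- Two coinciding points would carry a dependence that vanishes at a third index. -/
theorem injective [DecidableEq ι] (h : IsCircuit x a) (hc : 2 < Fintype.card ι) :
    Function.Injective x := by
  intro i j hij
  by_contra hne
  obtain ⟨k, -, hk⟩ : ∃ k ∈ Finset.univ, k ∉ ({i, j} : Finset ι) :=
    Finset.exists_mem_notMem_of_card_lt_card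
      (Finset.card_le_two.trans_lt (by rwa [Finset.card_univ]))
  simp only [Finset.mem_insert, Finset.mem_singleton, not_or] at hk
  obtain ⟨t, ht⟩ := h.unique (fun n => (if n = i then 1 else 0) - if n = j then 1 else 0)
    (by simp) (by simp [sub_smul, ite_smul, hij])
  have h1 := ht i
  have h2 := ht k
  simp only [hne, hk.1, hk.2, if_true, if_false, sub_zero] at h1 h2
  rcases mul_eq_zero.1 h2.symm with h3 | h3
  · rw [h3] at h1; simp at h1
  · exact h.ne_zero k h3

end Reindex

end IsCircuit

section Simplices

variable {α β V : Type*} [Fintype α] [Fintype β] [Nonempty α] [Nonempty β]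
  [NormedAddCommGroup V] [NormedSpace ℝ V] [FiniteDimensional ℝ V] {v : α → V} {w : β → V}

omit [Nonempty α] [FiniteDimensional ℝ V] in
theorem IsCircuit.affineIndependent_inl {a : α ⊕ β → ℝ} (h : IsCircuit (Sum.elim v w) a) :
    AffineIndependent ℝ v := by
  rw [affineIndependent_iff_forall_sum]
  intro b h1 h2 i
  obtain ⟨t, ht⟩ := h.unique (Sum.elim b 0) (by simpa using h1) (by simpa using h2)
  have h3 := ht (Sum.inr (Classical.arbitrary β))
  simp only [Sum.elim_inr, Pi.zero_apply] at h3
  have h4 := (mul_eq_zero.1 h3.symm).resolve_right (h.ne_zero _)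
  simpa [h4] using ht (Sum.inl i)

/-- The positive and the negative part of a circuit span simplices that meet in a relative interior
point of both. -/
theorem IsCircuit.exists_inter_eq_singleton {a : α ⊕ β → ℝ} (h : IsCircuit (Sum.elim v w) a)
    (hp : ∀ i, 0 < a (Sum.inl i)) (hn : ∀ j, a (Sum.inr j) < 0) :
    AffineIndependent ℝ v ∧ AffineIndependent ℝ w ∧ ∃ o : V,
      convexHull ℝ (Set.range v) ∩ convexHull ℝ (Set.range w) = {o} ∧
      o ∈ intrinsicInterior ℝ (convexHull ℝ (Set.range v)) ∧
      o ∈ intrinsicInterior ℝ (convexHull ℝ (Set.range w)) := by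
  have hv := h.affineIndependent_inl
  have hw : AffineIndependent ℝ w := by
    have h' := h.comp_equiv (Equiv.sumComm β α)
    have he : Sum.elim v w ∘ Equiv.sumComm β α = Sum.elim w v := by
      ext (i | i) <;> rfl
    rw [he] at h'
    exact h'.affineIndependent_inl
  set s : ℝ := ∑ i, a (Sum.inl i) with hs
  have hs0 : 0 < s := Finset.sum_pos (fun i _ => hp i) Finset.univ_nonempty
  have hsum : s = ∑ j, -a (Sum.inr j) := by
    have := h.sum_eq
    rw [Fintype.sum_sum_type] at this
    rw [Finset.sum_neg_distrib]
    linarith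
  have hsmul : ∑ i, a (Sum.inl i) • v i = ∑ j, -a (Sum.inr j) • w j := by
    have := h.sum_smul_eq
    rw [Fintype.sum_sum_type] at this
    simp only [Sum.elim_inl, Sum.elim_inr] at this
    simp only [neg_smul, Finset.sum_neg_distrib]
    exact eq_neg_of_add_eq_zero_left this
  have h1 : s⁻¹ • ∑ i, a (Sum.inl i) • v i ∈
      intrinsicInterior ℝ (convexHull ℝ (Set.range v)) := by
    refine (mem_intrinsicInterior_simplex_iff hv _).2 ⟨fun i => s⁻¹ * a (Sum.inl i),
      fun i => mul_pos (inv_pos.2 hs0) (hp i), ?_, ?_⟩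
    · rw [← Finset.mul_sum, ← hs, inv_mul_cancel₀ hs0.ne']
    · simp only [mul_smul, Finset.smul_sum]
  have h2 : s⁻¹ • ∑ i, a (Sum.inl i) • v i ∈
      intrinsicInterior ℝ (convexHull ℝ (Set.range w)) := by
    refine (mem_intrinsicInterior_simplex_iff hw _).2 ⟨fun j => s⁻¹ * -a (Sum.inr j),
      fun j => mul_pos (inv_pos.2 hs0) (neg_pos.2 (hn j)), ?_, ?_⟩
    · rw [← Finset.mul_sum, ← hsum, inv_mul_cancel₀ hs0.ne']
    · rw [hsmul]; simp only [mul_smul, Finset.smul_sum]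
  refine ⟨hv, hw, _, ?_, h1, h2⟩
  refine Set.eq_singleton_iff_unique_mem.2
    ⟨⟨intrinsicInterior_subset h1, intrinsicInterior_subset h2⟩, ?_⟩
  rintro p ⟨hpv, hpw⟩
  obtain ⟨c, -, hc1, rfl⟩ := (mem_convexHull_range_iff v _).1 hpv
  obtain ⟨c', -, hc1', hc'⟩ := (mem_convexHull_range_iff w _).1 hpw
  -- A common point of both simplices is itself a dependence, so a multiple of `a`; normalization
  -- fixes the factor.
  obtain ⟨t, ht⟩ := h.unique (Sum.elim c (-c')) (by simp [hc1, hc1']) (by simp [hc'])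
  have hct : ∀ i, c i = t * a (Sum.inl i) := fun i => ht (Sum.inl i)
  have hts : t * s = 1 := by rw [← hc1, hs, Finset.mul_sum]; simp only [hct]
  have hti : t = s⁻¹ := eq_inv_of_mul_eq_one_left hts
  simp only [hct, hti, mul_smul, Finset.smul_sum]

omit [FiniteDimensional ℝ V] [Nonempty α] [Nonempty β] in
theorem eventually_forall_add_mul_pos {c b : α → ℝ} (hc : ∀ i, 0 < c i) :
    ∀ᶠ ε in nhdsWithin (0 : ℝ) (Set.Ioi 0), ∀ i, 0 < c i + ε * b i := by
  refine Filter.Eventually.filter_mono nhdsWithin_le_nhds (Filter.eventually_all.2 fun i => ?_)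
  have : ContinuousAt (fun ε : ℝ => c i + ε * b i) 0 := by fun_prop
  exact this.eventually (lt_mem_nhds (by simpa using hc i))

omit [Nonempty β] in
/-- The vertices of two simplices that meet in a single point, which is in the relative interior
of both, form a circuit. -/
theorem exists_isCircuit_of_inter_eq_singleton (hv : AffineIndependent ℝ v)
    (hw : AffineIndependent ℝ w) {o : V}
    (ho : convexHull ℝ (Set.range v) ∩ convexHull ℝ (Set.range w) = {o})
    (hov : o ∈ intrinsicInterior ℝ (convexHull ℝ (Set.range v)))
    (how : o ∈ intrinsicInterior ℝ (convexHull ℝ (Set.range w))) :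
    ∃ a : α ⊕ β → ℝ, IsCircuit (Sum.elim v w) a ∧ (∀ i, 0 < a (Sum.inl i)) ∧
      ∀ j, a (Sum.inr j) < 0 := by
  obtain ⟨c, hc0, hc1, hc⟩ := (mem_intrinsicInterior_simplex_iff hv o).1 hov
  obtain ⟨c', hc0', hc1', hc'⟩ := (mem_intrinsicInterior_simplex_iff hw o).1 how
  refine ⟨Sum.elim c (-c'), ⟨?_, ?_, ?_, ?_⟩, hc0, fun j => by simpa using hc0' j⟩
  · rintro (i | j)
    · exact (hc0 i).ne'
    · simpa using (hc0' j).ne'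
  · simp [hc1, hc1']
  · simp [hc, hc']
  · intro b hb1 hb2
    rw [Fintype.sum_sum_type] at hb1 hb2
    simp only [Sum.elim_inl, Sum.elim_inr] at hb2
    -- Perturbing the coordinates of `o` by a small multiple of `b` and normalizing gives another
    -- common point, hence `o`. Uniqueness of barycentric coordinates then makes `b` proportional to
    -- the given dependence.
    obtain ⟨ε, ⟨he1, he2⟩, he0⟩ := (((eventually_forall_add_mul_pos
      (b := fun i => b (Sum.inl i)) hc0).and (eventually_forall_add_mul_pos
      (b := fun j => -b (Sum.inr j)) hc0')).and self_mem_nhdsWithin).exists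
    have he0' : ε ≠ 0 := (show (0 : ℝ) < ε from he0).ne'
    set s : ℝ := ∑ i, (c i + ε * b (Sum.inl i)) with hs
    have hs0 : 0 < s := Finset.sum_pos (fun i _ => he1 i) Finset.univ_nonempty
    have hs' : s = ∑ j, (c' j + ε * -b (Sum.inr j)) := by
      rw [hs, Finset.sum_add_distrib, Finset.sum_add_distrib, hc1, hc1', ← Finset.mul_sum,
        ← Finset.mul_sum, Finset.sum_neg_distrib, eq_neg_of_add_eq_zero_left hb1]
    have hpt : ∑ i, (c i + ε * b (Sum.inl i)) • v i =
        ∑ j, (c' j + ε * -b (Sum.inr j)) • w j := by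
      simp only [add_smul, mul_smul, neg_smul, Finset.sum_add_distrib, hc, hc', ← Finset.smul_sum,
        Finset.sum_neg_distrib, eq_neg_of_add_eq_zero_left hb2]
    have hmem : s⁻¹ • ∑ i, (c i + ε * b (Sum.inl i)) • v i ∈
        convexHull ℝ (Set.range v) ∩ convexHull ℝ (Set.range w) := by
      constructor
      · refine (mem_convexHull_range_iff v _).2 ⟨fun i => s⁻¹ * (c i + ε * b (Sum.inl i)),
          fun i => (mul_pos (inv_pos.2 hs0) (he1 i)).le, ?_, ?_⟩
        · rw [← Finset.mul_sum, ← hs, inv_mul_cancel₀ hs0.ne']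
        · simp only [mul_smul, Finset.smul_sum]
      · rw [hpt]
        refine (mem_convexHull_range_iff w _).2 ⟨fun j => s⁻¹ * (c' j + ε * -b (Sum.inr j)),
          fun j => (mul_pos (inv_pos.2 hs0) (he2 j)).le, ?_, ?_⟩
        · rw [← Finset.mul_sum, ← hs', inv_mul_cancel₀ hs0.ne']
        · simp only [mul_smul, Finset.smul_sum]
    rw [ho, Set.mem_singleton_iff, inv_smul_eq_iff₀ hs0.ne'] at hmem
    have k1 : ∀ i, c i + ε * b (Sum.inl i) = s * c i := fun i =>
      hv.eq_of_sum_eq_sum (s := Finset.univ) (w₁ := fun i => c i + ε * b (Sum.inl i))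
        (w₂ := fun i => s * c i) (by rw [← hs, ← Finset.mul_sum, hc1, mul_one])
        (by rw [hmem, ← hc]; simp only [Finset.smul_sum, mul_smul]) i (Finset.mem_univ i)
    have k2 : ∀ j, c' j + ε * -b (Sum.inr j) = s * c' j := fun j =>
      hw.eq_of_sum_eq_sum (s := Finset.univ) (w₁ := fun j => c' j + ε * -b (Sum.inr j))
        (w₂ := fun j => s * c' j) (by rw [← hs', ← Finset.mul_sum, hc1', mul_one])
        (by rw [← hpt, hmem, ← hc']; simp only [Finset.smul_sum, mul_smul]) j (Finset.mem_univ j)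
    refine ⟨(s - 1) / ε, ?_⟩
    rintro (i | j)
    · simp only [Sum.elim_inl]
      field_simp
      linarith [k1 i]
    · simp only [Sum.elim_inr, Pi.neg_apply]
      field_simp
      linarith [k2 j]

end Simplices

/-! ### The combinatorial type of a circuit -/

theorem IsCircuit.isModel {d m : ℕ} (hd : 1 ≤ d) (hm : m ≤ d) {x : Fin (d + 2) → E d}
    {a : Fin (d + 2) → ℝ} (h : IsCircuit x a) (hc : (posPart a).card = m + 1) :
    IsModel d m (convexHull ℝ (Set.range x)) := by
  have h1 : Fintype.card {i // 0 < a i} = m + 1 := by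
    rw [← hc, Fintype.card_subtype]; rfl
  have h2 : Fintype.card {i // ¬ 0 < a i} = d - m + 1 := by
    rw [Fintype.card_subtype_compl, h1, Fintype.card_fin]; omega
  let e₁ : Fin (m + 1) ≃ {i // 0 < a i} := (Fintype.equivFinOfCardEq h1).symm
  let e₂ : Fin (d - m + 1) ≃ {i // ¬ 0 < a i} := (Fintype.equivFinOfCardEq h2).symm
  let e : Fin (m + 1) ⊕ Fin (d - m + 1) ≃ Fin (d + 2) :=
    (Equiv.sumCongr e₁ e₂).trans (Equiv.sumCompl _)
  let v : Fin (m + 1) → E d := fun i => x (e₁ i)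
  let w : Fin (d - m + 1) → E d := fun i => x (e₂ i)
  have he : x ∘ e = Sum.elim v w := by ext (i | i) <;> rfl
  have h' := h.comp_equiv e
  rw [he] at h'
  obtain ⟨hv, hw, o, ho, hov, how⟩ := h'.exists_inter_eq_singleton
    (fun i => (e₁ i).2) (fun j => lt_of_le_of_ne (not_lt.1 (e₂ j).2) (h.ne_zero _))
  refine ⟨v, w, o, hv, hw, ?_, ho, hov, how, ?_⟩
  · rw [Set.disjoint_left]
    rintro _ ⟨i, rfl⟩ ⟨j, hj⟩
    have hij := h.injective (by rw [Fintype.card_fin]; omega) hj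
    exact (e₂ j).2 (hij ▸ (e₁ i).2)
  · rw [← Set.Sum.elim_range, ← he, Set.range_comp, e.range_eq_univ, Set.image_univ]

/-- The total number of faces is the combinatorial invariant used to tell the types apart. -/
theorem IsModel.ncard_exposed_add {d m : ℕ} (hm : m ≤ d) {T : Set (E d)} (h : IsModel d m T) :
    {F | IsExposed ℝ T F}.ncard + (2 ^ (m + 1) + 2 ^ (d - m + 1)) = 2 ^ (d + 2) + 2 := by
  obtain ⟨v, w, o, hv, hw, -, ho, hov, how, rfl⟩ := h
  obtain ⟨a, ha, hp, hn⟩ := exists_isCircuit_of_inter_eq_singleton hv hw ho hov how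
  have h1 := ha.ncard_exposed_add
  have h2 : posPart a = Finset.univ.map Function.Embedding.inl := by
    ext (i | j)
    · simp [mem_posPart, hp i]
    · simp [mem_posPart, (hn j).le]
  have h3 : (posPart a).card = m + 1 := by simp [h2]
  have h4 : Fintype.card (Fin (m + 1) ⊕ Fin (d - m + 1)) = d + 2 := by
    simp; omega
  have h5 : (posPart a)ᶜ.card = d - m + 1 := by
    rw [Finset.card_compl, h4, h3]; omega
  rwa [Set.Sum.elim_range, h3, h4, h5] at h1

theorem two_pow_add_two_pow_injOn {n a b : ℕ} (ha : 2 * a ≤ n) (hb : 2 * b ≤ n)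
    (h : 2 ^ (a + 1) + 2 ^ (n - a + 1) = 2 ^ (b + 1) + 2 ^ (n - b + 1)) : a = b := by
  have key : ∀ a b : ℕ, 2 * b ≤ n → a < b →
      2 ^ (b + 1) + 2 ^ (n - b + 1) < 2 ^ (a + 1) + 2 ^ (n - a + 1) := by
    intro a b hb hab
    have h1 : 2 ^ (b + 1) ≤ 2 ^ (n - b + 1) := Nat.pow_le_pow_right (by norm_num) (by omega)
    -- The sum for `b` is at most twice its larger term, which the larger term for `a` already
    -- dominates.
    have h2 : 2 ^ (n - b + 2) ≤ 2 ^ (n - a + 1) := Nat.pow_le_pow_right (by norm_num) (by omega)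
    have h3 : 0 < 2 ^ (a + 1) := by positivity
    rw [pow_succ 2 (n - b + 1)] at h2
    omega
  rcases lt_trichotomy a b with h1 | h1 | h1
  · exact absurd h (key a b hb h1).ne'
  · exact h1
  · exact absurd h (key b a ha h1).ne

/-- The convex hull of a circuit in `ℝ^d` is of type `T_m^d` if and only if its positive or its
negative part has `m + 1` points. -/
theorem IsCircuit.isOfType_iff {d m : ℕ} (hd : 1 ≤ d) (hm : m ≤ d / 2) {x : Fin (d + 2) → E d}
    {a : Fin (d + 2) → ℝ} (h : IsCircuit x a) :
    IsOfType d m (convexHull ℝ (Set.range x)) ↔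
      (posPart a).card = m + 1 ∨ (posPart a)ᶜ.card = m + 1 := by
  constructor
  · rintro ⟨-, T, hT, ⟨e⟩⟩
    have h1 : {F | IsExposed ℝ (convexHull ℝ (Set.range x)) F}.ncard =
        {F | IsExposed ℝ T F}.ncard := Nat.card_congr e.toEquiv
    have h2 := hT.ncard_exposed_add (by omega)
    have h3 := h.ncard_exposed_add
    rw [Fintype.card_fin, h1] at h3
    have h4 : (posPart a).card + (posPart a)ᶜ.card = d + 2 := by
      rw [Finset.card_add_card_compl, Fintype.card_fin]
    have h5 : 0 < (posPart a).card := by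
      obtain ⟨i, hi⟩ := h.exists_pos
      exact Finset.card_pos.2 ⟨i, mem_posPart.2 hi⟩
    have h6 : 0 < (posPart a)ᶜ.card := by
      obtain ⟨i, hi⟩ := h.exists_neg
      exact Finset.card_pos.2 ⟨i, h.mem_compl_posPart.2 hi⟩
    generalize (posPart a).card = p at *
    generalize (posPart a)ᶜ.card = q at *
    obtain ⟨p, rfl⟩ := Nat.exists_eq_succ_of_ne_zero h5.ne'
    obtain ⟨q, rfl⟩ := Nat.exists_eq_succ_of_ne_zero h6.ne'
    simp only [Nat.succ_eq_add_one] at *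
    rcases le_total p q with hpq | hpq
    · have hq : q = d - p := by omega
      have := two_pow_add_two_pow_injOn (n := d) (a := p) (b := m) (by omega) (by omega)
        (by rw [← hq]; omega)
      omega
    · have hp : p = d - q := by omega
      have := two_pow_add_two_pow_injOn (n := d) (a := q) (b := m) (by omega) (by omega)
        (by rw [← hp]; omega)
      omega
  · intro hc
    refine ⟨⟨_, Set.finite_range x, rfl⟩, _, ?_, ⟨OrderIso.refl _⟩⟩
    rcases hc with hc | hc
    · exact h.isModel hd (by omega) hc
    · exact h.neg.isModel hd (by omega) (by rwa [h.posPart_neg])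

/-! ### General position yields a circuit -/

/-- A nontrivial affine dependence of `d + 2` points in general position has no vanishing
coefficient. -/
theorem InGeneralAffinePosition.eq_zero_of_apply_eq_zero {d : ℕ} (hd : 1 ≤ d)
    {x : Fin (d + 2) → E d} (hx : InGeneralAffinePosition x) {b : Fin (d + 2) → ℝ}
    (h1 : ∑ i, b i = 0) (h2 : ∑ i, b i • x i = 0) {i₀ : Fin (d + 2)} (hi : b i₀ = 0) (i) :
    b i = 0 := by
  classical
  by_contra hne
  let y : {j // j ≠ i₀} → E d := fun j => x j
  have hdep : ¬ AffineIndependent ℝ y := by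
    rw [affineIndependent_iff_forall_sum]
    intro hy
    have e1 : ∑ j : {j // j ≠ i₀}, b j = 0 := by
      rw [← h1, ← Finset.sum_subtype (Finset.univ.filter (· ≠ i₀)) (by simp) b]
      refine Finset.sum_subset (Finset.filter_subset _ _) fun k _ hk => ?_
      rw [show k = i₀ by simpa using hk, hi]
    have e2 : ∑ j : {j // j ≠ i₀}, b j • y j = 0 := by
      rw [← h2, ← Finset.sum_subtype (Finset.univ.filter (· ≠ i₀)) (by simp) (fun j => b j • x j)]
      refine Finset.sum_subset (Finset.filter_subset _ _) fun k _ hk => ?_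
      rw [show k = i₀ by simpa using hk, hi, zero_smul]
    exact hne (hy (fun j => b j) e1 e2 ⟨i, fun h => hne (h ▸ hi)⟩)
  obtain ⟨n, rfl⟩ := Nat.exists_eq_add_of_le' hd
  have hcard : Fintype.card {j : Fin (n + 1 + 2) // j ≠ i₀} = n + 2 := by simp
  rw [affineIndependent_iff_not_finrank_vectorSpan_le ℝ y hcard, not_not] at hdep
  have hlt : vectorSpan ℝ (Set.range y) < ⊤ := by
    refine lt_top_iff_ne_top.2 fun h => ?_
    rw [h, finrank_top, finrank_euclideanSpace_fin] at hdep
    omega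
  -- The points other than `x i₀` are dependent, so all `d + 1` of them lie in a hyperplane parallel
  -- to `ker f`.
  obtain ⟨f, hf, hle⟩ := Submodule.exists_le_ker_of_lt_top _ hlt
  have hker := Module.Dual.finrank_ker_add_one_of_ne_zero hf
  rw [finrank_euclideanSpace_fin] at hker
  obtain ⟨j₀⟩ : Nonempty {j : Fin (n + 1 + 2) // j ≠ i₀} :=
    Fintype.card_pos_iff.1 (by omega)
  have := hx (AffineSubspace.mk' (x j₀) (LinearMap.ker f))
    ⟨x j₀, AffineSubspace.self_mem_mk' _ _⟩ (by rw [AffineSubspace.direction_mk']; exact hker)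
  have hsub : ({i₀}ᶜ : Set (Fin (n + 1 + 2))) ⊆
      {i | x i ∈ AffineSubspace.mk' (x j₀) (LinearMap.ker f)} := by
    intro j hj
    rw [Set.mem_ofPred_eq, AffineSubspace.mem_mk']
    exact hle (vsub_mem_vectorSpan ℝ ⟨⟨j, hj⟩, rfl⟩ ⟨j₀, rfl⟩)
  have h3 := Set.ncard_le_ncard hsub (Set.toFinite _)
  have h4 := Set.ncard_add_ncard_compl ({i₀} : Set (Fin (n + 1 + 2)))
  rw [Set.ncard_singleton, Nat.card_eq_fintype_card, Fintype.card_fin] at h4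
  omega

theorem InGeneralAffinePosition.exists_isCircuit {d : ℕ} (hd : 1 ≤ d) {x : Fin (d + 2) → E d}
    (hx : InGeneralAffinePosition x) : ∃ a, IsCircuit x a := by
  have hdep : ¬ AffineIndependent ℝ x := by
    intro h
    have h1 := h.card_le_finrank_succ
    have h2 := Submodule.finrank_le (vectorSpan ℝ (Set.range x))
    rw [finrank_euclideanSpace_fin] at h2
    rw [Fintype.card_fin] at h1
    omega
  rw [affineIndependent_iff_forall_sum] at hdep
  push Not at hdep
  obtain ⟨a, h1, h2, j, hj⟩ := hdep
  have hne : ∀ i, a i ≠ 0 := fun i hi => hj (hx.eq_zero_of_apply_eq_zero hd h1 h2 hi j)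
  refine ⟨a, hne, h1, h2, fun b hb1 hb2 => ⟨b 0 / a 0, fun i => ?_⟩⟩
  -- The multiple of `a` is chosen to cancel the coefficient at index `0`.
  have h3 := hx.eq_zero_of_apply_eq_zero hd (b := fun i => b i - b 0 / a 0 * a i)
    (by rw [Finset.sum_sub_distrib, ← Finset.mul_sum, h1, hb1]; simp)
    (by simp only [sub_smul, mul_smul, Finset.sum_sub_distrib, ← Finset.smul_sum, h2, hb2]; simp)
    (i₀ := 0) (by field_simp [hne 0]; simp) i
  exact sub_eq_zero.1 h3

/-! ### Closed sets that detect the type -/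

/-- The configurations with a nontrivial affine dependence that is nonnegative on `S` and
nonpositive off `S`. -/
def signedDependent {ι : Type*} [Fintype ι] (V : Type*) [AddCommGroup V] [Module ℝ V]
    (S : Finset ι) : Set (ι → V) :=
  {x | ∃ a : ι → ℝ, ∑ i, |a i| = 1 ∧ (∀ i, (i ∈ S → 0 ≤ a i) ∧ (i ∉ S → a i ≤ 0)) ∧
    ∑ i, a i = 0 ∧ ∑ i, a i • x i = 0}

/-- The normalization `∑ |a i| = 1` makes the coefficients range over a compact set, and projection
along a compact factor is closed. -/
theorem isClosed_signedDependent {ι V : Type*} [Fintype ι] [NormedAddCommGroup V]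
    [NormedSpace ℝ V] (S : Finset ι) : IsClosed (signedDependent V S) := by
  classical
  let K : Set (ι → ℝ) := {a | ∑ i, |a i| = 1}
  have hK : IsCompact K := by
    refine Metric.isCompact_of_isClosed_isBounded ?_ ?_
    · exact isClosed_eq (by fun_prop) continuous_const
    · refine (Metric.isBounded_closedBall (x := (0 : ι → ℝ)) (r := 1)).subset fun a ha => ?_
      rw [mem_closedBall_zero_iff, pi_norm_le_iff_of_nonneg zero_le_one]
      intro i
      rw [Real.norm_eq_abs, ← show ∑ i, |a i| = 1 from ha]
      exact Finset.single_le_sum (f := fun i => |a i|) (fun i _ => abs_nonneg _) (Finset.mem_univ i)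
  have : CompactSpace K := isCompact_iff_compactSpace.1 hK
  let C : Set (K × (ι → V)) := {p | (∀ i, (i ∈ S → 0 ≤ p.1.1 i) ∧ (i ∉ S → p.1.1 i ≤ 0)) ∧
    ∑ i, p.1.1 i = 0 ∧ ∑ i, p.1.1 i • p.2 i = 0}
  have hc : ∀ i, Continuous fun p : K × (ι → V) => p.1.1 i := fun i =>
    (continuous_apply i).comp (continuous_subtype_val.comp continuous_fst)
  have hx : ∀ i, Continuous fun p : K × (ι → V) => p.2 i := fun i =>
    (continuous_apply i).comp continuous_snd
  have hC : IsClosed C := by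
    have hsign : IsClosed {p : K × (ι → V) |
        ∀ i, (i ∈ S → 0 ≤ p.1.1 i) ∧ (i ∉ S → p.1.1 i ≤ 0)} := by
      simp only [Set.ofPred_forall, Set.ofPred_and]
      refine isClosed_iInter fun i => IsClosed.inter ?_ ?_
      · by_cases hi : i ∈ S
        · simpa [hi] using isClosed_le continuous_const (hc i)
        · simp [hi]
      · by_cases hi : i ∈ S
        · simp [hi]
        · simpa [hi] using isClosed_le (hc i) continuous_const
    exact hsign.inter
      ((isClosed_eq (continuous_finsetSum _ fun i _ => hc i) continuous_const).inter
        (isClosed_eq (continuous_finsetSum _ fun i _ => (hc i).smul (hx i)) continuous_const))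
  have hS : signedDependent V S = Prod.snd '' C := by
    ext x
    constructor
    · rintro ⟨a, h1, h2, h3, h4⟩
      exact ⟨(⟨a, h1⟩, x), ⟨h2, h3, h4⟩, rfl⟩
    · rintro ⟨⟨⟨a, h1⟩, x⟩, ⟨h2, h3, h4⟩, rfl⟩
      exact ⟨a, h1, h2, h3, h4⟩
  rw [hS]
  exact isClosedMap_snd_of_compactSpace C hC

theorem IsCircuit.mem_signedDependent_iff {ι V : Type*} [Fintype ι] [DecidableEq ι] [Nonempty ι]
    [NormedAddCommGroup V] [NormedSpace ℝ V] {x : ι → V} {a : ι → ℝ} (h : IsCircuit x a)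
    (S : Finset ι) : x ∈ signedDependent V S ↔ S = posPart a ∨ S = (posPart a)ᶜ := by
  have key : ∀ a : ι → ℝ, IsCircuit x a → x ∈ signedDependent V (posPart a) := by
    intro a h
    have hs : 0 < ∑ i, |a i| :=
      Finset.sum_pos (fun i _ => abs_pos.2 (h.ne_zero i)) Finset.univ_nonempty
    have hs' := inv_pos.2 hs
    refine ⟨fun i => (∑ i, |a i|)⁻¹ * a i, ?_, fun i => ⟨fun hi => ?_, fun hi => ?_⟩, ?_, ?_⟩
    · simp only [abs_mul, ← Finset.mul_sum, abs_of_pos hs']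
      exact inv_mul_cancel₀ hs.ne'
    · exact (mul_pos hs' (mem_posPart.1 hi)).le
    · exact mul_nonpos_of_nonneg_of_nonpos hs'.le (not_lt.1 (mt mem_posPart.2 hi))
    · rw [← Finset.mul_sum, h.sum_eq, mul_zero]
    · simp only [mul_smul, ← Finset.smul_sum, h.sum_smul_eq, smul_zero]
  constructor
  · rintro ⟨b, h1, h2, h3, h4⟩
    obtain ⟨t, ht⟩ := h.unique b h3 h4
    simp only [ht] at h2
    rcases lt_trichotomy t 0 with ht0 | rfl | ht0
    · right
      ext i
      rw [h.mem_compl_posPart]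
      refine ⟨fun hi => ?_, fun hi => ?_⟩
      · refine lt_of_le_of_ne ?_ (h.ne_zero i)
        by_contra hn
        exact absurd ((h2 i).1 hi) (not_le.2 (mul_neg_of_neg_of_pos ht0 (not_le.1 hn)))
      · by_contra hn
        exact absurd ((h2 i).2 hn) (not_le.2 (mul_pos_of_neg_of_neg ht0 hi))
    · simp [ht] at h1
    · left
      ext i
      rw [mem_posPart]
      refine ⟨fun hi => ?_, fun hi => ?_⟩
      · refine lt_of_le_of_ne ?_ (h.ne_zero i).symm
        by_contra hn
        exact absurd ((h2 i).1 hi) (not_le.2 (mul_neg_of_pos_of_neg ht0 (not_le.1 hn)))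
      · by_contra hn
        exact absurd ((h2 i).2 hn) (not_le.2 (mul_pos ht0 hi))
  · rintro (rfl | rfl)
    · exact key a h
    · rw [← h.posPart_neg]
      exact key _ h.neg

theorem InGeneralAffinePosition.isOfType_iff {d m : ℕ} (hd : 1 ≤ d) (hm : m ≤ d / 2)
    {x : Fin (d + 2) → E d} (hx : InGeneralAffinePosition x) :
    IsOfType d m (convexHull ℝ (Set.range x)) ↔
      ∃ S : Finset (Fin (d + 2)), S.card = m + 1 ∧ x ∈ signedDependent (E d) S := by
  obtain ⟨a, ha⟩ := hx.exists_isCircuit hd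
  simp only [ha.isOfType_iff hd hm, ha.mem_signedDependent_iff]
  constructor
  · rintro (h | h)
    · exact ⟨_, h, Or.inl rfl⟩
    · exact ⟨_, h, Or.inr rfl⟩
  · rintro ⟨S, h, rfl | rfl⟩
    · exact Or.inl h
    · exact Or.inr h

/-- Points in general position have exactly one type, and it determines the numbers of faces of
small dimension. -/
theorem InGeneralAffinePosition.exists_type {d : ℕ} (hd : 1 ≤ d) {x : Fin (d + 2) → E d}
    (hx : InGeneralAffinePosition x) : ∃ k ≤ d / 2,
      (∀ m ≤ d / 2, IsOfType d m (convexHull ℝ (Set.range x)) ↔ m = k) ∧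
      ∀ l ≤ d / 2, fVec l (convexHull ℝ (Set.range x)) +
        ((k + 1).choose (d + 1 - l) + (d + 1 - k).choose (d + 1 - l)) =
          (d + 2).choose (l + 1) := by
  obtain ⟨a, ha⟩ := hx.exists_isCircuit hd
  -- Replacing `a` by `-a` swaps the two parts, so the positive one may be taken as the smaller.
  have key : ∀ a : Fin (d + 2) → ℝ, IsCircuit x a → (posPart a).card ≤ (posPart a)ᶜ.card →
      ∃ k ≤ d / 2, (∀ m ≤ d / 2, IsOfType d m (convexHull ℝ (Set.range x)) ↔ m = k) ∧
      ∀ l ≤ d / 2, fVec l (convexHull ℝ (Set.range x)) +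
        ((k + 1).choose (d + 1 - l) + (d + 1 - k).choose (d + 1 - l)) =
          (d + 2).choose (l + 1) := by
    intro a ha hle
    have h4 : (posPart a).card + (posPart a)ᶜ.card = d + 2 := by
      rw [Finset.card_add_card_compl, Fintype.card_fin]
    obtain ⟨k, hk⟩ : ∃ k, (posPart a).card = k + 1 := by
      obtain ⟨i, hi⟩ := ha.exists_pos
      exact Nat.exists_eq_succ_of_ne_zero (Finset.card_pos.2 ⟨i, mem_posPart.2 hi⟩).ne'
    have hk' : (posPart a)ᶜ.card = d + 1 - k := by omega
    refine ⟨k, by omega, fun m hm => ?_, fun l hl => ?_⟩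
    · rw [ha.isOfType_iff hd hm, hk, hk']
      omega
    · have h5 := ha.ncard_faces_add (l := l) (by rw [Fintype.card_fin]; omega)
      rw [hk, hk', Fintype.card_fin, show d + 2 - (l + 1) = d + 1 - l by omega] at h5
      exact h5
  rcases le_total (posPart a).card (posPart a)ᶜ.card with h | h
  · exact key a ha h
  · exact key (-a) ha.neg (by rwa [ha.posPart_neg, compl_compl])

/-! ### Binomial inversion -/

/-- With `i = m - l`, the identity `C(N,s+i) C(s+i,s) = C(N,s) C(N-s,i)` for `s = n - m` leaves the
alternating sum of a full binomial row, which vanishes unless `N = s`. -/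
theorem alternating_sum_choose_mul_choose {n m N : ℕ} (hm : m ≤ n) (hN : N ≤ n) :
    ∑ l ∈ Finset.range (m + 1), (-1 : ℤ) ^ (m + l) * ((n - l).choose (n - m) : ℤ) *
      (N.choose (n - l) : ℤ) = if N = n - m then 1 else 0 := by
  rw [← Finset.sum_range_reflect]
  have h1 : ∀ i ∈ Finset.range (m + 1),
      (-1 : ℤ) ^ (m + (m + 1 - 1 - i)) * ((n - (m + 1 - 1 - i)).choose (n - m) : ℤ) *
        (N.choose (n - (m + 1 - 1 - i)) : ℤ) =
      (N.choose (n - m) : ℤ) * ((-1) ^ i * ((N - (n - m)).choose i : ℤ)) := by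
    intro i hi
    rw [Finset.mem_range] at hi
    have e1 : n - (m + 1 - 1 - i) = (n - m) + i := by omega
    have e2 : (-1 : ℤ) ^ (m + (m + 1 - 1 - i)) = (-1) ^ i := by
      rw [show m + (m + 1 - 1 - i) = 2 * (m - i) + i by omega, pow_add, pow_mul]
      simp
    have e3 := Nat.choose_mul (n := N) (k := (n - m) + i) (s := n - m) (by omega)
    rw [Nat.add_sub_cancel_left] at e3
    have e4 : (N.choose (n - m + i) : ℤ) * ((n - m + i).choose (n - m) : ℤ) =
        (N.choose (n - m) : ℤ) * ((N - (n - m)).choose i : ℤ) := by exact_mod_cast e3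
    rw [e1, e2]
    linear_combination (-1 : ℤ) ^ i * e4
  rw [Finset.sum_congr rfl h1, ← Finset.mul_sum]
  rcases lt_or_ge N (n - m) with h | h
  · rw [Nat.choose_eq_zero_of_lt h, if_neg h.ne]
    simp
  · have h2 : ∑ i ∈ Finset.range (m + 1), (-1 : ℤ) ^ i * ((N - (n - m)).choose i : ℤ) =
        ∑ i ∈ Finset.range (N - (n - m) + 1), (-1 : ℤ) ^ i * ((N - (n - m)).choose i : ℤ) := by
      refine (Finset.sum_subset (Finset.range_mono (by omega)) fun i _ hi => ?_).symm
      rw [Nat.choose_eq_zero_of_lt (by simpa using hi)]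
      simp
    rw [h2, Int.alternating_sum_range_choose]
    by_cases h3 : N = n - m
    · simp [h3]
    · rw [if_neg h3, if_neg (by omega), mul_zero]

/-- The linear system between face numbers and types is inverted by alternating sums. -/
theorem eta_mul_alternating_sum {d m k : ℕ} (hm : m ≤ d / 2) (hk : k ≤ d / 2) :
    1 / 2 * eta d m * ∑ l ∈ Finset.range (m + 1),
      (-1 : ℝ) ^ (m + l) * (Nat.choose (d - l + 1) (d - m + 1) : ℝ) *
        (((k + 1).choose (d + 1 - l) : ℝ) + ((d + 1 - k).choose (d + 1 - l) : ℝ)) =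
      if m = k then 1 else 0 := by
  have key : ∀ N ≤ d + 1, ∑ l ∈ Finset.range (m + 1),
      (-1 : ℝ) ^ (m + l) * (Nat.choose (d - l + 1) (d - m + 1) : ℝ) *
        (N.choose (d + 1 - l) : ℝ) = if N = d + 1 - m then 1 else 0 := by
    intro N hN
    have h := alternating_sum_choose_mul_choose (m := m) (n := d + 1) (by omega) hN
    have h' := congrArg (Int.cast : ℤ → ℝ) h
    push_cast at h'
    rw [← h']
    refine Finset.sum_congr rfl fun l hl => ?_
    rw [Finset.mem_range] at hl
    rw [show d - l + 1 = d + 1 - l by omega, show d - m + 1 = d + 1 - m by omega]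
  simp only [mul_add, Finset.sum_add_distrib]
  rw [← mul_add, key _ (by omega), key _ (by omega), eta]
  -- Both parts contribute `1` when `m = k = d / 2` exactly, and only the larger one when `m = k`
  -- otherwise; `eta` compensates for this.
  by_cases h1 : m = k
  · subst h1
    by_cases h2 : 2 * m = d
    · rw [if_pos h2, if_pos (by omega), if_pos rfl, if_pos rfl]; norm_num
    · rw [if_neg h2, if_neg (by omega), if_pos rfl, if_pos rfl]; norm_num
  · rw [if_neg (by omega : ¬ k + 1 = d + 1 - m), if_neg (by omega : ¬ d + 1 - k = d + 1 - m),
      if_neg h1]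
    norm_num

/-! ### Random points: measurability and expectations -/

section Random

variable {Ω : Type*} [MeasurableSpace Ω] {μ : Measure Ω} {d : ℕ} {X : Fin (d + 2) → Ω → E d}

theorem nullMeasurableSet_isOfType (hd : 1 ≤ d) (hX : ∀ i, Measurable (X i))
    (hgen : ∀ᵐ ω ∂μ, InGeneralAffinePosition fun i => X i ω) {m : ℕ} (hm : m ≤ d / 2) :
    NullMeasurableSet {ω | IsOfType d m (hull X ω)} μ := by
  have hXm : Measurable fun ω i => X i ω := measurable_pi_lambda _ hX
  have hmeas : MeasurableSet (⋃ S ∈ {S : Finset (Fin (d + 2)) | S.card = m + 1},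
      (fun ω i => X i ω) ⁻¹' signedDependent (E d) S) :=
    MeasurableSet.biUnion (Set.to_countable _) fun S _ =>
      hXm (isClosed_signedDependent S).measurableSet
  refine hmeas.nullMeasurableSet.congr (Filter.eventuallyEq_set.2 ?_)
  filter_upwards [hgen] with ω hω
  simp only [Set.mem_iUnion, Set.mem_preimage, exists_prop]
  exact (hω.isOfType_iff hd hm).symm

/-- Writing the face number through indicators of the types reduces its integrability to
measurability of those events. -/
theorem fVec_ae_eq (hd : 1 ≤ d) (hgen : ∀ᵐ ω ∂μ, InGeneralAffinePosition fun i => X i ω)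
    {l : ℕ} (hl : l ≤ d / 2) :
    (fun ω => (fVec l (hull X ω) : ℝ)) =ᵐ[μ] fun ω => ((d + 2).choose (l + 1) : ℝ) -
      ∑ k ∈ Finset.range (d / 2 + 1), {ω | IsOfType d k (hull X ω)}.indicator (fun _ =>
        ((k + 1).choose (d + 1 - l) : ℝ) + ((d + 1 - k).choose (d + 1 - l) : ℝ)) ω := by
  classical
  filter_upwards [hgen] with ω hω
  obtain ⟨k, hk, h1, h2⟩ := hω.exists_type hd
  rw [Finset.sum_eq_single_of_mem k (by rw [Finset.mem_range]; omega)]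
  · rw [Set.indicator_of_mem (show ω ∈ {ω | IsOfType d k (hull X ω)} from (h1 k hk).2 rfl),
      ← h2 l hl]
    push_cast
    rw [hull]
    ring
  · intro j hj hne
    rw [Finset.mem_range] at hj
    have hnot : ω ∉ {ω | IsOfType d j (hull X ω)} := fun h => hne ((h1 j (by omega)).1 h)
    exact Set.indicator_of_notMem hnot _

theorem integrable_fVec [IsFiniteMeasure μ] (hd : 1 ≤ d) (hX : ∀ i, Measurable (X i))
    (hgen : ∀ᵐ ω ∂μ, InGeneralAffinePosition fun i => X i ω) {l : ℕ} (hl : l ≤ d / 2) :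
    Integrable (fun ω => (fVec l (hull X ω) : ℝ)) μ := by
  refine Integrable.congr ?_ (fVec_ae_eq hd hgen hl).symm
  refine (integrable_const _).sub (integrable_finsetSum _ fun k hk => ?_)
  rw [Finset.mem_range] at hk
  exact (integrable_const _).indicator₀ (nullMeasurableSet_isOfType hd hX hgen (by omega))

theorem indicator_isOfType_ae_eq (hd : 1 ≤ d)
    (hgen : ∀ᵐ ω ∂μ, InGeneralAffinePosition fun i => X i ω) {m : ℕ} (hm : m ≤ d / 2) :
    {ω | IsOfType d m (hull X ω)}.indicator (fun _ => (1 : ℝ)) =ᵐ[μ] fun ω =>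
      1 / 2 * eta d m * ∑ l ∈ Finset.range (m + 1),
        (-1 : ℝ) ^ (m + l) * (Nat.choose (d - l + 1) (d - m + 1) : ℝ) *
          ((Nat.choose (d + 2) (l + 1) : ℝ) - (fVec l (hull X ω) : ℝ)) := by
  classical
  filter_upwards [hgen] with ω hω
  obtain ⟨k, hk, h1, h2⟩ := hω.exists_type hd
  have h3 : {ω | IsOfType d m (hull X ω)}.indicator (fun _ => (1 : ℝ)) ω =
      if m = k then 1 else 0 := by
    rw [Set.indicator_apply]
    exact if_congr (h1 m hm) rfl rfl
  rw [h3, ← eta_mul_alternating_sum hm hk]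
  congr 1
  refine Finset.sum_congr rfl fun l hl => ?_
  rw [Finset.mem_range] at hl
  rw [← h2 l (by omega)]
  push_cast
  rw [hull]
  ring

end Random

end SylvesterTypes

theorem mainTheorem6 {Ω : Type*} [MeasurableSpace Ω] (μ : Measure Ω) [IsProbabilityMeasure μ]
    (d : ℕ) (hd : 1 ≤ d) (X : Fin (d + 2) → Ω → SylvesterTypes.E d)
    (hX : ∀ i, Measurable (X i))
    (hgen : ∀ᵐ ω ∂μ, SylvesterTypes.InGeneralAffinePosition fun i => X i ω)
    (m : ℕ) (hm : m ≤ d / 2) :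
    NullMeasurableSet {ω | SylvesterTypes.IsOfType d m (SylvesterTypes.hull X ω)} μ ∧
    (∀ l ≤ m, Integrable (fun ω => (SylvesterTypes.fVec l (SylvesterTypes.hull X ω) : ℝ)) μ) ∧
    μ.real {ω | SylvesterTypes.IsOfType d m (SylvesterTypes.hull X ω)} =
      1 / 2 * SylvesterTypes.eta d m *
        ∑ l ∈ Finset.range (m + 1),
          (-1 : ℝ) ^ (m + l) * (Nat.choose (d - l + 1) (d - m + 1) : ℝ) *
            ((Nat.choose (d + 2) (l + 1) : ℝ) -
              ∫ ω, (SylvesterTypes.fVec l (SylvesterTypes.hull X ω) : ℝ) ∂μ) := by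

  have hint : ∀ l ≤ m, Integrable
      (fun ω => (SylvesterTypes.fVec l (SylvesterTypes.hull X ω) : ℝ)) μ :=
    fun l hl => SylvesterTypes.integrable_fVec hd hX hgen (hl.trans hm)
  have hnull := SylvesterTypes.nullMeasurableSet_isOfType hd hX hgen hm
  refine ⟨hnull, hint, ?_⟩
  have h1 : μ.real {ω | SylvesterTypes.IsOfType d m (SylvesterTypes.hull X ω)} =
      ∫ ω, {ω | SylvesterTypes.IsOfType d m (SylvesterTypes.hull X ω)}.indicator
        (fun _ => (1 : ℝ)) ω ∂μ := by
    rw [integral_indicator₀ hnull]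
    simp
  rw [h1, integral_congr_ae (SylvesterTypes.indicator_isOfType_ae_eq hd hgen hm),
    integral_const_mul, integral_finsetSum]
  · congr 1
    refine Finset.sum_congr rfl fun l hl => ?_
    rw [Finset.mem_range] at hl
    rw [integral_const_mul, integral_sub (integrable_const _) (hint l (by omega)), integral_const]
    simp
  · intro l hl
    rw [Finset.mem_range] at hl
    exact ((integrable_const _).sub (hint l (by omega))).const_mul _
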